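/- Notation. For an ideal $I$ on a set $X$, $\mathcal P(X)/I$ is the quotient Boolean algebra and $[A]_I$ the class of $A\subseteq X$; $I$ is $\delta$-complete if it is closed under unions of fewer than $\delta$ of its members, and uniform if it contains every $Y\subseteq X$ with $|Y|<|X|$; for a set $M$, $M^X/I$ is the reduced power, i.e. the set of functions $f:X\to M$ modulo the relation $\{x: f(x)\neq g(x)\}\in I$, with classes $[f]_I$. An ideal on $\kappa^+$ is normal if it contains all bounded sets and is closed under diagonal unions. $\mathrm{Col}(\kappa,\kappa^+)$ is the set of partial functions from $\kappa$ to $\kappa^+$ with domain of size $<\kappa$, ordered by reverse inclusion; $\mathcal B(\mathbb P)$ is the complete Boolean algebra of regular open subsets of the poset $\mathbb P$; $\mathrm{cof}(\kappa)$ is the class of ordinals of cofinality $\kappa$; and $\diamondsuit_{\kappa^+}(\mathrm{cof}(\kappa))$ says that there is a sequence $\langle d_\alpha:\alpha\in\kappa^+\cap\mathrm{cof}(\kappa)\rangle$ with $d_\alpha\subseteq\alpha$ such that for every $A\subseteq\kappa^+$ the set $\{\alpha\in\kappa^+\cap\mathrm{cof}(\kappa): A\cap\alpha=d_\alpha\}$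 is stationary in $\kappa^+$. Statement. Let $\kappa$ be a regular (infinite) cardinal. Assume that $\diamondsuit_{\kappa^+}(\mathrm{cof}(\kappa))$ holds and that there is a normal ideal $J$ on $\kappa^+$ such that $\mathcal P(\kappa^+)/J\cong\mathcal B(\mathrm{Col}(\kappa,\kappa^+))$. Then there is a function $\pi:\kappa^+\to\kappa$ such that for every regular cardinal $\delta\le\kappa$ and every $\delta$-complete uniform ideal $I$ on $\kappa$ there is a $\delta$-complete uniform ideal $I'$ on $\kappa^+$ (proper if $I$ is) with the following properties: 1. $I=\{A\subseteq\kappa:\pi^{-1}[A]\in I'\}$. 2. $[A]_I\mapsto[\pi^{-1}[A]]_{I'}$ is a well-defined isomorphism from $\mathcal P(\kappa)/I$ to $\mathcal P(\kappa^+)/I'$; in particular $\mathcal P(\kappa)/I\cong\mathcal P(\kappa^+)/I'$. 3. For every $\mu\le\kappa$, $[f]_I\mapsto[f\circ\pi]_{I'}$ is a well-defined bijection from $\mu^\kappa/I$ to $\mu^{\kappa^+}/I'$. -/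

import Mathlib

open Cardinal Set

universe u

/-! ### Ideals on a set

An ideal on a set `X` is a Mathlib order ideal `I : Order.Ideal (Set X)`: a nonempty family of
subsets of `X` closed under subsets and finite unions.  `I.IsProper` says `X ∉ I`. -/

namespace SetIdeal

/-- `I` is `δ`-complete: the union of fewer than `δ` members of `I` is in `I`. -/
def IsComplete {X : Type u} (I : Order.Ideal (Set X)) (δ : Cardinal.{u}) : Prop :=
  ∀ S : Set (Set X), #S < δ → (∀ A ∈ S, A ∈ I) → ⋃₀ S ∈ I

/-- `I` is uniform: every subset of `X` of size `< |X|` is in `I`. -/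
def IsUniform {X : Type u} (I : Order.Ideal (Set X)) : Prop :=
  ∀ Y : Set X, #Y < #X → Y ∈ I

/-- An ideal on (the underlying set of) a linear order, in practice a regular uncountable cardinal,
is normal: it contains every bounded set, and it is closed under diagonal unions
`{b | ∃ a < b, b ∈ A a}`. (These two conditions imply completeness.) -/
def IsNormal {X : Type u} [LinearOrder X] (J : Order.Ideal (Set X)) : Prop :=
  (∀ a : X, Iic a ∈ J) ∧
    ∀ A : X → Set X, (∀ a, A a ∈ J) → {b : X | ∃ a < b, b ∈ A a} ∈ J

/-- Inclusion of subsets of `X` modulo `I`. -/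
def LEMod {X : Type u} (I : Order.Ideal (Set X)) (A B : Set X) : Prop := A \ B ∈ I

theorem LEMod.refl {X : Type u} (I : Order.Ideal (Set X)) (A : Set X) : LEMod I A A := by
  unfold LEMod
  rw [sdiff_self]
  exact Order.Ideal.bot_mem I

theorem LEMod.trans {X : Type u} {I : Order.Ideal (Set X)} {A B C : Set X}
    (h₁ : LEMod I A B) (h₂ : LEMod I B C) : LEMod I A C := by
  refine I.lower ?_ (Order.Ideal.sup_mem h₁ h₂)
  intro x hx
  by_cases hB : x ∈ B
  · exact Or.inr ⟨hB, hx.2⟩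
  · exact Or.inl ⟨hx.1, hB⟩

/-- Equality of subsets of `X` modulo `I`: the symmetric difference is in `I`. -/
def modSetoid {X : Type u} (I : Order.Ideal (Set X)) : Setoid (Set X) where
  r A B := symmDiff A B ∈ I
  iseqv := by
    have key : ∀ A B : Set X, symmDiff A B ∈ I ↔ LEMod I A B ∧ LEMod I B A := fun A B =>
      Order.Ideal.sup_mem_iff
    refine ⟨fun A => ?_, fun {A B} h => ?_, fun {A B C} h₁ h₂ => ?_⟩
    · exact (key A A).2 ⟨LEMod.refl I A, LEMod.refl I A⟩
    · exact (key B A).2 ((key A B).1 h).symm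
    · exact (key A C).2 ⟨((key A B).1 h₁).1.trans ((key B C).1 h₂).1,
        ((key B C).1 h₂).2.trans ((key A B).1 h₁).2⟩

theorem modSetoid_iff {X : Type u} (I : Order.Ideal (Set X)) (A B : Set X) :
    (modSetoid I) A B ↔ LEMod I A B ∧ LEMod I B A :=
  Order.Ideal.sup_mem_iff

/-- The quotient Boolean algebra `𝒫(X)/I`. -/
def PowerMod {X : Type u} (I : Order.Ideal (Set X)) : Type u := Quotient (modSetoid I)

/-- The class `[A]_I` of a subset `A` of `X` in `𝒫(X)/I`. -/
def PowerMod.mk {X : Type u} (I : Order.Ideal (Set X)) (A : Set X) : PowerMod I :=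
  Quotient.mk (modSetoid I) A

/-- The Boolean ordering of `𝒫(X)/I`: `[A] ≤ [B]` iff `A \ B ∈ I`.  An isomorphism of Boolean
algebras is the same thing as an isomorphism of their orderings. -/
instance {X : Type u} (I : Order.Ideal (Set X)) : PartialOrder (PowerMod I) where
  le := Quotient.lift₂ (LEMod I) (by
    intro A B A' B' hA hB
    have hA := (modSetoid_iff I A A').1 hA
    have hB := (modSetoid_iff I B B').1 hB
    exact propext ⟨fun h => (hA.2.trans h).trans hB.1, fun h => (hA.1.trans h).trans hB.2⟩)
  le_refl := by
    rintro ⟨A⟩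
    exact LEMod.refl I A
  le_trans := by
    rintro ⟨A⟩ ⟨B⟩ ⟨C⟩ h₁ h₂
    exact LEMod.trans (I := I) (A := A) (B := B) (C := C) h₁ h₂
  le_antisymm := by
    rintro ⟨A⟩ ⟨B⟩ h₁ h₂
    exact Quotient.sound ((modSetoid_iff I A B).2 ⟨h₁, h₂⟩)

theorem PowerMod.mk_le_mk {X : Type u} (I : Order.Ideal (Set X)) (A B : Set X) :
    PowerMod.mk I A ≤ PowerMod.mk I B ↔ A \ B ∈ I :=
  Iff.rfl

/-- The filter dual to `I`: the complements of the members of `I`. -/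
def dualFilter {X : Type u} (I : Order.Ideal (Set X)) : Filter X where
  sets := {A | Aᶜ ∈ I}
  univ_sets := by
    rw [mem_ofPred_eq, compl_univ]
    exact Order.Ideal.bot_mem I
  sets_of_superset := fun {A B} hA hAB => I.lower (compl_subset_compl.2 hAB) hA
  inter_sets := fun {A B} hA hB => by
    rw [mem_ofPred_eq, compl_inter]
    exact Order.Ideal.sup_mem hA hB

/-- The reduced power `M^X/I`: functions `X → M` modulo the relation `{x | f x ≠ g x} ∈ I`. -/
abbrev ReducedPower {X : Type u} (M : Type u) (I : Order.Ideal (Set X)) : Type u :=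
  Filter.Germ (dualFilter I) M

/-- The class `[f]_I` of `f : X → M` in the reduced power. -/
def ReducedPower.mk {X M : Type u} (I : Order.Ideal (Set X)) (f : X → M) : ReducedPower M I :=
  Filter.Germ.ofFun f

theorem ReducedPower.mk_eq_iff {X M : Type u} (I : Order.Ideal (Set X)) (f g : X → M) :
    ReducedPower.mk I f = ReducedPower.mk I g ↔ {x | f x ≠ g x} ∈ I :=
  Filter.Germ.coe_eq

end SetIdeal

/-! ### The collapse and its Boolean completion -/

/-- `Col(κ, lam)`: partial functions from `κ` to `lam` defined at fewer than `κ` points. -/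
structure Col (κ lam : Cardinal.{u}) : Type u where
  /-- The partial function; `none` means undefined. -/
  toFun : κ.ord.ToType → Option lam.ord.ToType
  small_dom : #{a | toFun a ≠ none} < κ

/-- `Col(κ, lam)` is ordered by reverse inclusion. -/
instance (κ lam : Cardinal.{u}) : PartialOrder (Col κ lam) where
  le p q := ∀ a b, q.toFun a = some b → p.toFun a = some b
  le_refl p a b h := h
  le_trans p q r h₁ h₂ a b h := h₁ a b (h₂ a b h)
  le_antisymm := by
    rintro ⟨p, hp⟩ ⟨q, hq⟩ h₁ h₂
    have : p = q := by
      funext a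
      exact Option.ext fun b => ⟨h₂ a b, h₁ a b⟩
    subst this
    rfl

/-- The Boolean completion `ℬ(P)` of a separative poset `P`: the Boolean algebra of regular open
subsets of `P`, where the open sets are the downward closed ones. -/
abbrev BooleanCompletion (P : Type u) [PartialOrder P] : Type u :=
  Heyting.Regular (LowerSet P)

/-- `U ⊆ P` is regular open iff it contains every `p` below which `U` is dense. -/
theorem isRegular_lowerSet_iff {P : Type u} [PartialOrder P] (U : LowerSet P) :
    Heyting.IsRegular U ↔ ∀ p : P, (∀ q ≤ p, ∃ r ≤ q, r ∈ U) → p ∈ U := by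
  have hc : ∀ (V : LowerSet P) (p : P), p ∈ Vᶜ ↔ ∀ q ≤ p, q ∉ V := by
    intro V p
    rw [← LowerSet.Iic_le, le_compl_iff_disjoint_right, disjoint_iff_inf_le]
    constructor
    · intro h q hq hV
      exact LowerSet.notMem_bot (h ⟨hq, hV⟩)
    · intro h q hq
      exact (h q hq.1 hq.2).elim
  have hcc : ∀ p : P, p ∈ Uᶜᶜ ↔ ∀ q ≤ p, ∃ r ≤ q, r ∈ U := by
    intro p
    simp only [hc, not_forall, not_not, exists_prop]
  constructor
  · intro h p hp
    have := (hcc p).2 hp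
    rwa [h] at this
  · intro h
    refine le_antisymm (fun p hp => h p ((hcc p).1 hp)) le_compl_compl

/-! ### Diamond -/

/-- The points of `X` (in practice, ordinals) of cofinality `κ`. -/
def cofSet (X : Type u) [LinearOrder X] (κ : Cardinal.{u}) : Set X :=
  {a | Order.cof (Iio a) = κ}

/-- `◇(S)`, for a set `S` of points of `X` (in practice, a regular uncountable cardinal): there are
`d a ⊆ {x | x < a}`, `a ∈ S`, such that every `A ⊆ X` is guessed at stationarily many `a ∈ S`. -/
def Diamond {X : Type u} [LinearOrder X] (S : Set X) : Prop :=
  ∃ d : X → Set X, (∀ a ∈ S, d a ⊆ Iio a) ∧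
    ∀ A : Set X, IsStationary {a | a ∈ S ∧ A ∩ Iio a = d a}

/-!
The quotient `𝒫(κ⁺)/J` has a dense subset isomorphic to `P = Col(κ, κ⁺)`; let `S p ⊆ κ⁺` represent
the condition `p` (`SetIdeal.exists_isDenseRep`). Fix an antichain `⟨a i : i < κ⟩` in `P`, and let
`π` send `S (a i)` to `i`, up to sets in `J`.

The heart of the proof is a sequence of functions `p α : κ → P`, `α < κ⁺`, which descends modulo
bounded subsets of `κ`, starts below `a`, and meets every dense subset `D` of `P`: for some `α`,
`p α i ∈ D` for almost all `i < κ` (`exists_generic_tower`). The reduced power of `P` modulo bounded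
sets is `κ⁺`-closed because `P` is `<κ`-closed, so the recursion can be continued through all
`α < κ⁺`. There may be `2 ^ κ⁺` dense sets to meet, and this is where diamond comes in: at stage `α`
one enters, if possible, the set coded by the `α`-th guess. If `D` is guessed correctly at `α`, where
`α` has cofinality `κ` and is closed under a suitable function, this is possible inside `D`. The
closure argument needs `κ ^< κ = κ`, which follows from the existence of `J`, since forcing with
`𝒫(κ⁺)/J` adds no sequences of ordinals of length `< κ` (`SetIdeal.IsDenseRep.powerlt_le`).

Given `I`, let `A ∈ I'` iff for some `α`, the set `A` is `J`-null on `S (p α i)` for `I`-almost all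
`i` (`SetIdeal.IsGenericTower.ideal`). As `J` is `κ⁺`-complete and `I` contains the bounded sets,
`I'` inherits its completeness from `I`. As `S (p α i)` concentrates on `π ⁻¹' {i}`, the preimage
`π ⁻¹' A` is in `I'` iff `A ∈ I`. Finally, each `F : κ⁺ → μ` with `μ ≤ κ` is decided by densely many
conditions, hence by `p α i` for some `α` and almost all `i`, with a value `g i`; then `F = g ∘ π`
modulo `I'` (`SetIdeal.IsGenericTower.exists_comp_eq`). This gives surjectivity of both maps, the case
of `𝒫(κ)/I` being that of functions with two values.
-/

open Filter

/-! ### Regular cardinals, small sets and closure points -/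

theorem Cardinal.IsRegular.exists_forall_lt {c : Cardinal.{u}} (hc : c.IsRegular)
    (s : Set c.ord.ToType) (hs : #s < c) : ∃ b, ∀ x ∈ s, x < b := by
  rw [← not_isCofinal_iff]
  intro h
  have := (Order.cof_le h).trans_lt hs
  rw [Ordinal.cof_toType, hc.cof_ord] at this
  exact this.false

theorem Cardinal.mk_Iio_toType_lt {c : Cardinal.{u}} (i : c.ord.ToType) : #(Iio i) < c := by
  simpa using mk_Iio_lt i

theorem Cardinal.mk_Iic_toType_lt {c : Cardinal.{u}} (hc : ℵ₀ ≤ c) (i : c.ord.ToType) :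
    #(Iic i) < c := by
  rw [← Iio_insert]
  exact (mk_insert_le).trans_lt
    (add_lt_of_lt hc (mk_Iio_toType_lt i) (one_lt_aleph0.trans_le hc))

theorem Cardinal.IsRegular.eventually_all {c : Cardinal.{u}} (hc : c.IsRegular) {ι : Type u}
    (hι : #ι < c) {p : ι → c.ord.ToType → Prop} (h : ∀ j, ∀ᶠ i in atTop, p j i) :
    ∀ᶠ i in atTop, ∀ j, p j i := by
  have : Nonempty c.ord.ToType := nonempty_ord_toType hc.ne_zero
  simp only [eventually_atTop] at h ⊢
  choose b hb using h
  obtain ⟨m, hm⟩ := hc.exists_forall_lt (range b) (mk_range_le.trans_lt hι)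
  exact ⟨m, fun i hi j => hb j i ((hm _ ⟨j, rfl⟩).le.trans hi)⟩

/-- If `κ ^< κ = κ`, then a set of size `≤ κ` has at most `κ` subsets of size `< κ`. -/
theorem Cardinal.IsRegular.mk_small_subsets_le {κ : Cardinal.{u}} (hκ : κ.IsRegular)
    (hpow : κ ^< κ ≤ κ) {T : Type u} (t : Set T) (ht : #t ≤ κ) :
    #{s : Set T | s ⊆ t ∧ #s < κ} ≤ κ := by
  have hsub : {s : Set T | s ⊆ t ∧ #s < κ} ⊆
      ⋃ i : κ.ord.ToType, {s : Set T | s ⊆ t ∧ #s ≤ #(Iio i)} := by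
    rintro s ⟨hst, hs⟩
    have hle : #s ≤ #κ.ord.ToType := by
      rw [mk_ord_toType]
      exact hs.le
    obtain ⟨e⟩ := hle
    obtain ⟨b, hb⟩ := hκ.exists_forall_lt (range e) (mk_range_le.trans_lt hs)
    exact mem_iUnion.2 ⟨b, hst, mk_le_of_injective (f := fun x => (⟨e x, hb _ ⟨x, rfl⟩⟩ : Iio b))
      fun x y h => e.injective (congrArg Subtype.val h)⟩
  refine (mk_le_mk_of_subset hsub).trans ((mk_iUnion_le _).trans ?_)
  rw [mk_ord_toType]
  refine (mul_le_mul_right (ciSup_le' fun i => ?_) κ).trans (mul_eq_self hκ.aleph0_le).le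
  refine (mk_bounded_subset_le t _).trans ?_
  exact (power_le_power_right (max_le ht hκ.aleph0_le)).trans
    (powerlt_le.1 hpow _ (mk_Iio_toType_lt i))

/-- Fewer than `cof a` points below `a` are bounded below `a`. -/
theorem exists_lt_of_mk_lt_cof {Y : Type u} [LinearOrder Y] {a : Y} {s : Set Y} (hs : s ⊆ Iio a)
    (hcard : #s < Order.cof (Iio a)) : ∃ b < a, ∀ x ∈ s, x < b := by
  have : ¬ IsCofinal ((↑) ⁻¹' s : Set (Iio a)) := by
    intro h
    exact ((Order.cof_le h).trans
      (mk_preimage_of_injective _ _ Subtype.val_injective)).not_gt hcard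
  obtain ⟨b, hb⟩ := not_isCofinal_iff.1 this
  exact ⟨b, b.2, fun x hx => hb ⟨x, hs hx⟩ hx⟩

/-- The points of `κ⁺` closed under a set mapping with values of size `≤ κ` form a club. -/
theorem isClub_closurePoints {κ : Cardinal.{u}} (hκ : ℵ₀ ≤ κ)
    (F : (Order.succ κ).ord.ToType → Set (Order.succ κ).ord.ToType) (hF : ∀ b, #(F b) ≤ κ) :
    IsClub {a | ∀ b < a, ∀ y ∈ F b, y < a} := by
  have hreg := isRegular_succ hκ
  refine ⟨fun d hd _ _ a ha b hb y hy => ?_, fun a => ?_⟩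
  · obtain ⟨x, hx, hbx⟩ := (lt_isLUB_iff ha).1 hb
    exact (hd hx b hbx y hy).trans_le (ha.1 hx)
  · have hf : ∀ x : (Order.succ κ).ord.ToType, ∃ z, ∀ b ≤ x, ∀ y ∈ F b, y < z := by
      intro x
      have hsm : #(⋃ b : Iic x, F b) < Order.succ κ := by
        rw [Order.lt_succ_iff]
        refine (mk_iUnion_le _).trans ?_
        exact (mul_le_mul' (Order.lt_succ_iff.1 (mk_Iic_toType_lt hreg.aleph0_le x))
        (ciSup_le' fun b : Iic x => hF b)).trans (mul_eq_self hκ).le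
      obtain ⟨z, hz⟩ := hreg.exists_forall_lt _ hsm
      exact ⟨z, fun b hb y hy => hz y (mem_iUnion.2 ⟨⟨b, hb⟩, hy⟩)⟩
    choose f hf using hf
    -- iterate `f` countably often above `a`, and take the supremum
    let g : ℕ → (Order.succ κ).ord.ToType := fun n => (fun x => max x (f x))^[n] a
    have hg : ∀ n, g (n + 1) = max (g n) (f (g n)) := fun n =>
      Function.iterate_succ_apply' _ _ _
    have hsm : #(range g) < Order.succ κ :=
      ((le_aleph0_iff_set_countable.2 (countable_range g)).trans hκ).trans_lt
        (Order.lt_succ κ)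
    obtain ⟨z, hz⟩ := hreg.exists_forall_lt _ hsm
    obtain ⟨m, hm, hmin⟩ := wellFounded_lt.has_min (upperBounds (range g))
      ⟨z, fun x hx => (hz x hx).le⟩
    refine ⟨m, fun b hb y hy => ?_, hm ⟨0, rfl⟩⟩
    have : b ∉ upperBounds (range g) := fun h => hmin b h hb
    simp only [upperBounds, mem_range, forall_exists_index, forall_apply_eq_imp_iff,
      mem_ofPred_eq, not_forall, not_le] at this
    obtain ⟨n, hn⟩ := this
    refine (hf (g n) b hn.le y hy).trans_le (le_trans ?_ (hm ⟨n + 1, rfl⟩))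
    rw [hg]
    exact le_max_right _ _

/-! ### Towers -/

/-- Transfinite recursion along a well-order: if every `r`-descending sequence can be continued,
there is an `r`-descending sequence which moreover satisfies `B` at each step at which it can be
continued so as to satisfy `B`. -/
theorem exists_descending {Λ : Type*} {Q : Type*} [LinearOrder Λ] [WellFoundedLT Λ] [Nonempty Q]
    (r : Q → Q → Prop)
    (h : ∀ (α : Λ) (f : Λ → Q), (∀ β < α, ∀ γ < β, r (f β) (f γ)) → ∃ q, ∀ β < α, r q (f β))
    (B : Λ → Q → Prop) :
    ∃ p : Λ → Q, (∀ α, ∀ β < α, r (p α) (p β)) ∧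
      ∀ α q, (∀ β < α, r q (p β)) → B α q → B α (p α) := by
  classical
  let pick : ∀ α : Λ, (∀ β : Λ, β < α → Q) → Q := fun α g =>
    if h : ∃ q, (∀ β hβ, r q (g β hβ)) ∧ B α q then h.choose
    else if h : ∃ q, ∀ β hβ, r q (g β hβ) then h.choose else Classical.arbitrary Q
  let p : Λ → Q := WellFoundedLT.fix pick
  have hp : ∀ α, p α = pick α fun β _ => p β := fun α => WellFoundedLT.fix_eq pick α
  have hr : ∀ α, ∀ β < α, r (p α) (p β) := by
    intro α
    induction α using WellFoundedLT.induction with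
    | ind α ih =>
      have hex := h α p ih
      rw [hp α]
      by_cases hB : ∃ q, (∀ β, β < α → r q (p β)) ∧ B α q
      · simp only [pick, dif_pos hB]
        exact hB.choose_spec.1
      · simp only [pick, dif_neg hB, dif_pos hex]
        exact hex.choose_spec
  refine ⟨p, hr, fun α q hq hBq => ?_⟩
  have hB : ∃ q, (∀ β, β < α → r q (p β)) ∧ B α q := ⟨q, hq, hBq⟩
  rw [hp α]
  simp only [pick, dif_pos hB]
  exact hB.choose_spec.2

/-- `P` is `<κ`-closed: every chain of size `< κ` has a lower bound. -/
def IsChainClosed (κ : Cardinal.{u}) (P : Type u) [Preorder P] : Prop :=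
  ∀ s : Set P, #s < κ → IsChain (· ≤ ·) s → BddBelow s

/-- The combinatorial core of the `κ⁺`-closure of a reduced power `P^κ` modulo bounded sets: from
a sequence of length `≤ κ` that descends modulo bounded sets, one can select at each coordinate
`i < κ` fewer than `κ` members whose `i`-th entries form a chain, so that each member is selected
at almost all coordinates. -/
theorem exists_small_chains {κ : Cardinal.{u}} (hκ : κ.IsRegular) {T P : Type u} [LinearOrder T]
    [Preorder P] (hT : #T ≤ κ) (f : T → κ.ord.ToType → P)
    (hf : ∀ β γ, β < γ → ∀ᶠ i in atTop, f γ i ≤ f β i) :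
    ∃ s : κ.ord.ToType → Set T, (∀ i, #(s i) < κ) ∧
      (∀ i, IsChain (· ≤ ·) ((fun β => f β i) '' s i)) ∧ ∀ β, ∀ᶠ i in atTop, β ∈ s i := by
  have hle : #T ≤ #κ.ord.ToType := by rwa [mk_ord_toType]
  obtain ⟨e⟩ := hle
  refine ⟨fun i => {β | e β < i ∧ IsChain (· ≤ ·) ((fun β => f β i) '' {γ | e γ ≤ e β})},
    fun i => ?_, fun i => ?_, fun β => ?_⟩
  · refine lt_of_le_of_lt ?_ (mk_Iio_toType_lt i)
    exact mk_le_of_injective (f := fun β => (⟨e β.1, β.2.1⟩ : Iio i))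
      fun x y h => Subtype.ext (e.injective (congrArg Subtype.val h))
  · rintro _ ⟨β, hβ, rfl⟩ _ ⟨γ, hγ, rfl⟩ hne
    rcases le_total (e β) (e γ) with h | h
    · exact hγ.2 ⟨β, h, rfl⟩ ⟨γ, le_refl (e γ), rfl⟩ hne
    · exact hβ.2 ⟨β, le_refl (e β), rfl⟩ ⟨γ, h, rfl⟩ hne
  · have hsm : #{γ | e γ ≤ e β} < κ := by
      refine lt_of_le_of_lt ?_ (mk_Iic_toType_lt hκ.aleph0_le (e β))
      exact mk_le_of_injective (f := fun γ => (⟨e γ.1, γ.2⟩ : Iic (e β)))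
        fun x y h => Subtype.ext (e.injective (congrArg Subtype.val h))
    have hpair : ∀ᶠ i in atTop, ∀ γ : {γ | e γ ≤ e β}, ∀ δ : {γ | e γ ≤ e β},
        f γ i ≤ f δ i ∨ f δ i ≤ f γ i := by
      refine hκ.eventually_all hsm fun γ => hκ.eventually_all hsm fun δ => ?_
      rcases lt_trichotomy γ.1 δ.1 with h | h | h
      · exact (hf _ _ h).mono fun i hi => Or.inr hi
      · exact Eventually.of_forall fun i => Or.inl (by rw [h])
      · exact (hf _ _ h).mono fun i hi => Or.inl hi
    have : NoMaxOrder κ.ord.ToType := noMaxOrder hκ.aleph0_le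
    filter_upwards [hpair, eventually_gt_atTop (e β)] with i hi hlt
    refine ⟨hlt, ?_⟩
    rintro _ ⟨γ, hγ, rfl⟩ _ ⟨δ, hδ, rfl⟩ _
    exact hi ⟨γ, hγ⟩ ⟨δ, hδ⟩

/-- `◇_{κ⁺}(cof κ)` yields a `κ⁺`-tower in `P^κ` modulo bounded sets, below a given `a`, which
meets every dense subset of `P` at almost all coordinates. At stage `α`, the tower enters at all
coordinates the subset of `P` coded by the `α`-th guess, if it can. For a dense set `D` guessed at
a sufficiently closed `α` of cofinality `κ` it can, since then each selection of fewer than `κ`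
conditions from earlier stages has a lower bound in the part of `D` guessed at `α`. -/
theorem exists_generic_tower {κ : Cardinal.{u}} (hκ : κ.IsRegular) (hpow : κ ^< κ ≤ κ)
    (hdiamond : Diamond (cofSet (Order.succ κ).ord.ToType κ)) {P : Type u} [Preorder P]
    (hP : IsChainClosed κ P) (hcard : #P ≤ Order.succ κ) (a : κ.ord.ToType → P) :
    ∃ p : (Order.succ κ).ord.ToType → κ.ord.ToType → P, (∀ α i, p α i ≤ a i) ∧
      (∀ α, ∀ β < α, ∀ᶠ i in atTop, p α i ≤ p β i) ∧
      ∀ D : Set P, (∀ p, ∃ q ≤ p, q ∈ D) → ∃ α, ∀ᶠ i in atTop, p α i ∈ D := by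
  classical
  obtain ⟨d, -, hd⟩ := hdiamond
  have hle : #P ≤ #(Order.succ κ).ord.ToType := by rwa [mk_ord_toType]
  obtain ⟨c⟩ := hle
  let Q := {f : κ.ord.ToType → P // ∀ i, f i ≤ a i}
  have : Nonempty Q := ⟨⟨a, fun _ => le_rfl⟩⟩
  let r : Q → Q → Prop := fun f g => ∀ᶠ i in atTop, f.1 i ≤ g.1 i
  -- the sets selected at the coordinates, together with the values of `a`
  have hsel : ∀ (α : (Order.succ κ).ord.ToType) (f : (Order.succ κ).ord.ToType → Q),
      (∀ β < α, ∀ γ < β, r (f β) (f γ)) → ∃ t : κ.ord.ToType → Set P,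
        (∀ i, #(t i) < κ ∧ IsChain (· ≤ ·) (t i) ∧ a i ∈ t i ∧
          ∀ x ∈ t i, x = a i ∨ ∃ β < α, x = (f β).1 i) ∧
        ∀ β < α, ∀ᶠ i in atTop, (f β).1 i ∈ t i := by
    intro α f hf
    obtain ⟨s, hs, hchain, hmem⟩ := exists_small_chains hκ (T := Iio α)
      (Order.lt_succ_iff.1 (mk_Iio_toType_lt α)) (fun β i => (f β).1 i)
      (fun β γ h => hf γ γ.2 β h)
    refine ⟨fun i => insert (a i) ((fun β : Iio α => (f β).1 i) '' s i),
      fun i => ⟨?_, ?_, mem_insert _ _, ?_⟩, fun β hβ => ?_⟩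
    · exact mk_insert_le.trans_lt (add_lt_of_lt hκ.aleph0_le
        (mk_image_le.trans_lt (hs i)) (one_lt_aleph0.trans_le hκ.aleph0_le))
    · refine (hchain i).insert ?_
      rintro _ ⟨β, -, rfl⟩ -
      exact Or.inr ((f β).2 i)
    · rintro x (rfl | ⟨β, -, rfl⟩)
      · exact Or.inl rfl
      · exact Or.inr ⟨β, β.2, rfl⟩
    · exact (hmem ⟨β, hβ⟩).mono fun i hi => Or.inr ⟨⟨β, hβ⟩, hi, rfl⟩
  obtain ⟨p, hp, hB⟩ := exists_descending r (by
    intro α f hf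
    obtain ⟨t, ht, hmem⟩ := hsel α f hf
    choose q hq using fun i => hP (t i) (ht i).1 (ht i).2.1
    exact ⟨⟨q, fun i => hq i (ht i).2.2.1⟩, fun β hβ => (hmem β hβ).mono fun i hi => hq i hi⟩)
    (fun α q => ∀ i, c (q.1 i) ∈ d α)
  refine ⟨fun α => (p α).1, fun α => (p α).2, hp, fun D hD => ?_⟩
  -- `h` chooses lower bounds in `D`
  have hlow : ∀ s : Set P, ∃ x : P, BddBelow s → x ∈ D ∧ x ∈ lowerBounds s := by
    intro s
    by_cases hs : BddBelow s
    · obtain ⟨y, hy⟩ := hs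
      obtain ⟨x, hxy, hx⟩ := hD y
      exact ⟨x, fun _ => ⟨hx, fun z hz => hxy.trans (hy hz)⟩⟩
    · have : Nonempty κ.ord.ToType := nonempty_ord_toType hκ.ne_zero
      exact ⟨a (Classical.arbitrary _), fun h => (hs h).elim⟩
  choose h hh using hlow
  let W : (Order.succ κ).ord.ToType → Set (Set P) := fun β => {s | s ⊆ c ⁻¹' Iic β ∧ #s < κ}
  have hW : ∀ β, #(W β) ≤ κ := fun β => hκ.mk_small_subsets_le hpow _
    ((mk_preimage_of_injective _ _ c.injective).trans
      (Order.lt_succ_iff.1 (mk_Iic_toType_lt (isRegular_succ hκ.aleph0_le).aleph0_le β)))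
  let F : (Order.succ κ).ord.ToType → Set (Order.succ κ).ord.ToType := fun β =>
    ((fun s => c (h s)) '' W β ∪ range fun i => c ((p β).1 i)) ∪ range fun i => c (a i)
  have hrange : ∀ g : κ.ord.ToType → (Order.succ κ).ord.ToType, #(range g) ≤ κ := fun g =>
    mk_range_le.trans (mk_ord_toType κ).le
  have hF : ∀ β, #(F β) ≤ κ := fun β =>
    (mk_union_le _ _).trans (add_le_of_le hκ.aleph0_le ((mk_union_le _ _).trans
      (add_le_of_le hκ.aleph0_le (mk_image_le.trans (hW β)) (hrange _))) (hrange _))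
  obtain ⟨α, ⟨hcof, hguess⟩, hα⟩ := hd (c '' D) (isClub_closurePoints hκ.aleph0_le F hF)
  have hcof : Order.cof (Iio α) = κ := hcof
  obtain ⟨t, ht, hmem⟩ := hsel α p fun β _ => hp β
  have hne : (Iio α).Nonempty := by
    rw [← nonempty_coe_sort, ← Order.cof_ne_zero_iff, hcof]
    exact hκ.ne_zero
  obtain ⟨β₀, hβ₀⟩ := hne
  have hbelow : ∀ i, c '' t i ⊆ Iio α := by
    rintro i _ ⟨x, hx, rfl⟩
    rcases (ht i).2.2.2 x hx with rfl | ⟨β, hβ, rfl⟩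
    · exact hα β₀ hβ₀ _ (Or.inr ⟨i, rfl⟩)
    · exact hα β hβ _ (Or.inl (Or.inr ⟨i, rfl⟩))
  have hq : ∀ i, c (h (t i)) < α := by
    intro i
    obtain ⟨β, hβ, hb⟩ := exists_lt_of_mk_lt_cof (hbelow i)
      (by rw [hcof]; exact mk_image_le.trans_lt (ht i).1)
    exact hα β hβ _ (Or.inl (Or.inl ⟨t i, ⟨fun x hx => (hb _ ⟨x, hx, rfl⟩).le, (ht i).1⟩, rfl⟩))
  have hht : ∀ i, h (t i) ∈ D ∧ h (t i) ∈ lowerBounds (t i) := fun i =>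
    hh _ (hP _ (ht i).1 (ht i).2.1)
  have key := hB α ⟨fun i => h (t i), fun i => (hht i).2 (ht i).2.2.1⟩
    (fun β hβ => (hmem β hβ).mono fun i hi => (hht i).2 hi)
    (fun i => hguess ▸ ⟨⟨_, (hht i).1, rfl⟩, hq i⟩)
  refine ⟨α, Eventually.of_forall fun i => ?_⟩
  have hk := key i
  rw [← hguess] at hk
  obtain ⟨x, hx, hxe⟩ := hk.1
  have hxe : x = (p α).1 i := c.injective hxe
  change (p α).1 i ∈ D
  rwa [← hxe]

/-! ### Dense subsets of a quotient algebra -/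

namespace SetIdeal

theorem mem_of_sdiff_mem {X : Type u} {I : Order.Ideal (Set X)} {A B : Set X} (h : A \ B ∈ I)
    (hB : B ∈ I) : A ∈ I :=
  I.lower (fun x hx => by by_cases hxB : x ∈ B <;> [exact Or.inr hxB; exact Or.inl ⟨hx, hxB⟩])
    (Order.Ideal.sup_mem h hB)

/-- A normal ideal on `κ⁺` is `κ⁺`-complete. -/
theorem IsNormal.iUnion_mem {κ : Cardinal.{u}} (hκ : ℵ₀ ≤ κ)
    {J : Order.Ideal (Set (Order.succ κ).ord.ToType)} (hJ : IsNormal J) {ι : Type u}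
    (hι : #ι ≤ κ) (A : ι → Set (Order.succ κ).ord.ToType) (hA : ∀ i, A i ∈ J) :
    ⋃ i, A i ∈ J := by
  have hle : #ι ≤ #(Order.succ κ).ord.ToType := by
    rw [mk_ord_toType]
    exact hι.trans (Order.le_succ κ)
  obtain ⟨e⟩ := hle
  obtain ⟨b, hb⟩ := (isRegular_succ hκ).exists_forall_lt (range e)
    (mk_range_le.trans_lt (Order.lt_succ_iff.2 hι))
  have hdiag := hJ.2 (fun y => ⋃ (i : ι) (_ : e i = y), A i) (fun y => by
    by_cases hy : ∃ i, e i = y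
    · obtain ⟨i, rfl⟩ := hy
      refine J.lower ?_ (hA i)
      simp only [e.injective.eq_iff, iUnion_iUnion_eq_left, subset_refl]
    · refine J.lower ?_ (Order.Ideal.bot_mem J)
      exact iUnion₂_subset fun i hi => (hy ⟨i, hi⟩).elim)
  refine J.lower ?_ (Order.Ideal.sup_mem (hJ.1 b) hdiag)
  rintro x hx
  obtain ⟨i, hi⟩ := mem_iUnion.1 hx
  rcases le_or_gt x b with h | h
  · exact Or.inl h
  · exact Or.inr ⟨e i, (hb _ ⟨i, rfl⟩).trans h, mem_iUnion₂.2 ⟨i, rfl, hi⟩⟩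

/-- `p ↦ [S p]_J` is a dense embedding, in the sense of forcing, of `P` into the nonzero elements of
`𝒫(X)/J`: it preserves order and incompatibility, and its range is dense. -/
structure IsDenseRep {X P : Type u} [PartialOrder P] (J : Order.Ideal (Set X)) (S : P → Set X) :
    Prop where
  notMem : ∀ p, S p ∉ J
  mono : ∀ p q, p ≤ q → S p \ S q ∈ J
  inter_mem : ∀ p q, (∀ r, r ≤ p → ¬ r ≤ q) → S p ∩ S q ∈ J
  dense : ∀ A, A ∉ J → ∃ p, S p \ A ∈ J

/-- The regular open set generated by a condition `p`: the conditions below which `p` is dense. -/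
def regularCone {P : Type u} [PartialOrder P] (p : P) : BooleanCompletion P :=
  ⟨⟨{r | ∀ q ≤ r, ∃ s ≤ q, s ≤ p}, fun _ _ hba h q hq => h q (hq.trans hba)⟩,
    (isRegular_lowerSet_iff _).2 fun _ h q hq => by
      obtain ⟨r, hr, hrU⟩ := h q hq
      obtain ⟨s, hs, hsp⟩ := hrU r le_rfl
      exact ⟨s, hs.trans hr, hsp⟩⟩

theorem mem_regularCone {P : Type u} [PartialOrder P] {p r : P} :
    r ∈ (regularCone p).val ↔ ∀ q ≤ r, ∃ s ≤ q, s ≤ p :=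
  Iff.rfl

theorem regularCone_le {P : Type u} [PartialOrder P] {p : P} {U : BooleanCompletion P} :
    regularCone p ≤ U ↔ p ∈ U.val := by
  constructor
  · intro h
    exact h (mem_regularCone.2 fun q hq => ⟨q, le_rfl, hq⟩)
  · intro h r hr
    refine (isRegular_lowerSet_iff _).1 U.prop r fun q hq => ?_
    obtain ⟨s, hs, hsp⟩ := mem_regularCone.1 hr q hq
    exact ⟨s, hs, U.val.lower hsp h⟩

theorem exists_isDenseRep {X P : Type u} [PartialOrder P] {J : Order.Ideal (Set X)}
    (e : PowerMod J ≃o BooleanCompletion P) : ∃ S : P → Set X, IsDenseRep J S := by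
  have hmk : ∀ x : PowerMod J, ∃ A, PowerMod.mk J A = x := by
    rintro ⟨A⟩
    exact ⟨A, rfl⟩
  choose S hS using fun p => hmk (e.symm (regularCone p))
  -- `A ∈ J` iff the regular open set corresponding to `A` is empty
  have hle : ∀ p A, S p \ A ∈ J ↔ p ∈ (e (PowerMod.mk J A)).val := by
    intro p A
    rw [← PowerMod.mk_le_mk, hS, e.symm_apply_le, regularCone_le]
  have hmem : ∀ A, A ∈ J ↔ ∀ p, p ∉ (e (PowerMod.mk J A)).val := by
    intro A
    have h0 : A ∈ J ↔ PowerMod.mk J A ≤ PowerMod.mk J ∅ := by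
      rw [PowerMod.mk_le_mk, sdiff_empty]
    have hbot : e (PowerMod.mk J ∅) = ⊥ := by
      rw [eq_bot_iff, ← e.le_symm_apply]
      obtain ⟨B, hB⟩ := hmk (e.symm ⊥)
      rw [← hB, PowerMod.mk_le_mk, empty_sdiff]
      exact Order.Ideal.bot_mem J
    rw [h0, ← e.le_iff_le, hbot]
    constructor
    · intro h p hp
      exact LowerSet.notMem_bot (h hp)
    · intro h p hp
      exact (h p hp).elim
  refine ⟨S, fun p hp => ?_, fun p q hpq => ?_, fun p q hpq => ?_, fun A hA => ?_⟩
  · refine (hmem _).1 hp p ((hle _ _).1 ?_)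
    rw [sdiff_self]
    exact Order.Ideal.bot_mem J
  · rw [hle, hS, e.apply_symm_apply, mem_regularCone]
    exact fun r hr => ⟨r, le_rfl, hr.trans hpq⟩
  · rw [hmem]
    intro r hr
    have hsub : ∀ t, S p ∩ S q ⊆ S t → r ∈ (regularCone t).val := by
      intro t ht
      have : e (PowerMod.mk J (S p ∩ S q)) ≤ regularCone t := by
        rw [← e.le_symm_apply, ← hS, PowerMod.mk_le_mk, sdiff_eq_empty.2 ht]
        exact Order.Ideal.bot_mem J
      exact this hr
    obtain ⟨s, hs, hsp⟩ := mem_regularCone.1 (hsub p inter_subset_left) r le_rfl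
    obtain ⟨t, ht, htq⟩ := mem_regularCone.1 (hsub q inter_subset_right) s hs
    exact hpq t (ht.trans hsp) htq
  · simp only [hmem, not_forall, not_not] at hA
    obtain ⟨p, hp⟩ := hA
    exact ⟨p, (hle _ _).2 hp⟩

theorem IsDenseRep.exists_le {X P : Type u} [PartialOrder P] {J : Order.Ideal (Set X)}
    {S : P → Set X} (hS : IsDenseRep J S) (p : P) (A : Set X) (h : S p ∩ A ∉ J) :
    ∃ q ≤ p, S q \ A ∈ J := by
  obtain ⟨q, hq⟩ := hS.dense _ h
  have hcomp : ∃ r, r ≤ q ∧ r ≤ p := by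
    by_contra! hno
    refine hS.notMem q (J.lower ?_ (Order.Ideal.sup_mem hq (hS.inter_mem q p hno)))
    intro x hxq
    by_cases hxp : x ∈ S p
    · exact Or.inr ⟨hxq, hxp⟩
    · exact Or.inl ⟨hxq, fun h => hxp h.1⟩
  obtain ⟨r, hrq, hrp⟩ := hcomp
  refine ⟨r, hrp, J.lower ?_ (Order.Ideal.sup_mem (hS.mono r q hrq) hq)⟩
  rintro x ⟨hxr, hxA⟩
  by_cases hxq : x ∈ S q
  · exact Or.inr ⟨hxq, fun h => hxA h.2⟩
  · exact Or.inl ⟨hxr, hxq⟩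

/-- If `J` is `κ⁺`-complete, the conditions deciding the value of a function with at most `κ`
values are dense. -/
theorem IsDenseRep.exists_decides {κ : Cardinal.{u}} {X P : Type u} [PartialOrder P]
    {J : Order.Ideal (Set X)} {S : P → Set X} (hS : IsDenseRep J S)
    (hJ : ∀ (ι : Type u), #ι ≤ κ → ∀ A : ι → Set X, (∀ i, A i ∈ J) → ⋃ i, A i ∈ J)
    {M : Type u} (hM : #M ≤ κ) (F : X → M) (p : P) :
    ∃ q ≤ p, ∃ m, S q \ F ⁻¹' {m} ∈ J := by
  have : ∃ m, S p ∩ F ⁻¹' {m} ∉ J := by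
    by_contra! h
    refine hS.notMem p (J.lower ?_ (hJ M hM _ h))
    exact fun x hx => mem_iUnion.2 ⟨F x, hx, rfl⟩
  obtain ⟨m, hm⟩ := this
  obtain ⟨q, hq, h⟩ := hS.exists_le p _ hm
  exact ⟨q, hq, m, h⟩

/-- If `𝒫(κ⁺)/J` has a `<κ`-closed dense subset, then `κ ^< κ = κ`. Otherwise there is an injection
of `κ⁺` into the functions from some `γ < κ` to `κ`; deciding its values one by one along a
descending sequence of length `γ`, one finds a positive set on which it is constant modulo `J`. -/
theorem IsDenseRep.powerlt_le {κ : Cardinal.{u}} (hκ : κ.IsRegular)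
    {J : Order.Ideal (Set (Order.succ κ).ord.ToType)} (hJ : IsNormal J) {P : Type u}
    [PartialOrder P] [Nonempty P] (hP : IsChainClosed κ P)
    {S : P → Set (Order.succ κ).ord.ToType} (hS : IsDenseRep J S) : κ ^< κ ≤ κ := by
  rw [Cardinal.powerlt_le]
  intro γ hγ
  by_contra! hlt
  have hle : #(Order.succ κ).ord.ToType ≤ #(γ.ord.ToType → κ.ord.ToType) := by
    rw [mk_ord_toType, ← power_def, mk_ord_toType, mk_ord_toType]
    exact Order.succ_le_of_lt hlt
  obtain ⟨F⟩ := hle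
  have hdec : ∀ (ξ : γ.ord.ToType) (p : P), ∃ q ≤ p, ∃ m, S q \ (fun y => F y ξ) ⁻¹' {m} ∈ J :=
    fun ξ p => hS.exists_decides (fun ι hι A hA => hJ.iUnion_mem hκ.aleph0_le hι A hA)
      (mk_ord_toType κ).le _ p
  have hbdd : ∀ (T : Set γ.ord.ToType) (f : γ.ord.ToType → P),
      (∀ β ∈ T, ∀ δ ∈ T, δ < β → f β ≤ f δ) → BddBelow (f '' T) := by
    intro T f hf
    refine hP _ ((mk_image_le.trans (mk_set_le T)).trans_lt (by rwa [mk_ord_toType])) ?_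
    rintro _ ⟨β, hβ, rfl⟩ _ ⟨δ, hδ, rfl⟩ hne
    rcases lt_trichotomy β δ with h | rfl | h
    · exact Or.inr (hf _ hδ _ hβ h)
    · exact (hne rfl).elim
    · exact Or.inl (hf _ hβ _ hδ h)
  have hstep : ∀ (α : γ.ord.ToType) (f : γ.ord.ToType → P),
      (∀ β < α, ∀ δ < β, f β ≤ f δ) →
        ∃ q, (∀ β < α, q ≤ f β) ∧ ∃ m, S q \ (fun y => F y α) ⁻¹' {m} ∈ J := by
    intro α f hf
    obtain ⟨b, hb⟩ := hbdd (Iio α) f fun β hβ δ _ h => hf β hβ δ h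
    obtain ⟨q, hq, hm⟩ := hdec α b
    exact ⟨q, fun β hβ => hq.trans (hb ⟨β, hβ, rfl⟩), hm⟩
  obtain ⟨p, hp, hB⟩ := exists_descending (· ≤ ·)
    (fun α f hf => (hstep α f hf).imp fun q hq => hq.1)
    (fun α q => ∃ m, S q \ (fun y => F y α) ⁻¹' {m} ∈ J)
  have hdecided : ∀ α, ∃ m, S (p α) \ (fun y => F y α) ⁻¹' {m} ∈ J := by
    intro α
    obtain ⟨q, hq, hm⟩ := hstep α p fun β _ => hp β
    exact hB α q hq hm
  choose m hm using hdecided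
  obtain ⟨b, hb⟩ := hbdd Set.univ p fun β _ δ _ h => hp β δ h
  have hbm : ∀ α, S b \ (fun y => F y α) ⁻¹' {m α} ∈ J := by
    intro α
    refine J.lower ?_ (Order.Ideal.sup_mem (hS.mono b (p α) (hb ⟨α, trivial, rfl⟩)) (hm α))
    rintro x ⟨hxb, hx⟩
    by_cases hxp : x ∈ S (p α)
    · exact Or.inr ⟨hxp, hx⟩
    · exact Or.inl ⟨hxb, hxp⟩
  refine hS.notMem b (mem_of_sdiff_mem (B := {y | F y = m}) ?_ ?_)
  · refine J.lower ?_ (hJ.iUnion_mem hκ.aleph0_le ((mk_ord_toType γ).trans_le hγ.le) _ hbm)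
    rintro x ⟨hxb, hx⟩
    obtain ⟨α, hα⟩ := Function.ne_iff.1 hx
    exact mem_iUnion.2 ⟨α, hxb, hα⟩
  · by_cases hne : ∃ y, F y = m
    · obtain ⟨y, rfl⟩ := hne
      exact J.lower (fun z hz => (F.injective hz).le) (hJ.1 y)
    · exact J.lower (fun z hz => (hne ⟨z, hz⟩).elim) (Order.Ideal.bot_mem J)

end SetIdeal

/-! ### The collapse -/

namespace Col

theorem isChainClosed {κ lam : Cardinal.{u}} (hκ : κ.IsRegular) :
    IsChainClosed κ (Col κ lam) := by
  classical
  intro s hs hchain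
  have huniq : ∀ p ∈ s, ∀ q ∈ s, ∀ a b b', p.toFun a = some b → q.toFun a = some b' →
      b = b' := by
    intro p hp q hq a b b' hb hb'
    rcases hchain.total hp hq with h | h
    · exact Option.some.inj (hb.symm.trans (h a b' hb'))
    · exact Option.some.inj ((h a b hb).symm.trans hb')
  let f : κ.ord.ToType → Option lam.ord.ToType := fun a =>
    if h : ∃ b, ∃ p ∈ s, p.toFun a = some b then some h.choose else none
  have hdom : {a | f a ≠ none} ⊆ ⋃ p : s, {a | p.1.toFun a ≠ none} := by
    intro a ha
    by_cases h : ∃ b, ∃ p ∈ s, p.toFun a = some b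
    · obtain ⟨b, p, hp, hb⟩ := h
      exact mem_iUnion.2 ⟨⟨p, hp⟩, by simp [hb]⟩
    · exact (ha (dif_neg h)).elim
  refine ⟨⟨f, (mk_le_mk_of_subset hdom).trans_lt
    ((card_iUnion_lt_iff_forall_of_isRegular hκ hs).2 fun p => p.1.small_dom)⟩, ?_⟩
  intro p hp a b hb
  have h : ∃ b, ∃ p ∈ s, p.toFun a = some b := ⟨b, p, hp, hb⟩
  obtain ⟨q, hq, hqb⟩ := h.choose_spec
  change f a = some b
  rw [show f a = some h.choose from dif_pos h, huniq q hq p hp a _ b hqb hb]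

theorem mk_le {κ : Cardinal.{u}} (hκ : κ.IsRegular) (hpow : κ ^< κ ≤ κ) :
    #(Col κ (Order.succ κ)) ≤ Order.succ κ := by
  let graph : Col κ (Order.succ κ) → Set (κ.ord.ToType × (Order.succ κ).ord.ToType) :=
    fun p => {x | p.toFun x.1 = some x.2}
  have hinj : Function.Injective graph := by
    intro p q h
    have : ∀ a b, p.toFun a = some b ↔ q.toFun a = some b := fun a b =>
      Set.ext_iff.1 h (a, b)
    exact le_antisymm (fun a b => (this a b).2) fun a b => (this a b).1
  have hsmall : ∀ p, #(graph p) < κ := by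
    intro p
    refine lt_of_le_of_lt ?_ p.small_dom
    refine mk_le_of_injective (f := fun x => (⟨x.1.1, by
      rw [mem_ofPred_eq, show p.toFun x.1.1 = some x.1.2 from x.2]
      exact Option.some_ne_none _⟩ : {a | p.toFun a ≠ none})) ?_
    rintro ⟨⟨a, b⟩, hx⟩ ⟨⟨a', b'⟩, hy⟩ h
    obtain rfl : a = a' := congrArg Subtype.val h
    have : b = b' := Option.some.inj (Eq.trans (Eq.symm hx) hy)
    subst this
    rfl
  let N : (Order.succ κ).ord.ToType →
      Set (Set (κ.ord.ToType × (Order.succ κ).ord.ToType)) := fun y =>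
    {s | s ⊆ Set.univ ×ˢ Iic y ∧ #s < κ}
  have hreg := isRegular_succ hκ.aleph0_le
  have hsub : range graph ⊆ ⋃ y, N y := by
    rintro _ ⟨p, rfl⟩
    obtain ⟨y, hy⟩ := hreg.exists_forall_lt (Prod.snd '' graph p)
      ((mk_image_le.trans (hsmall p).le).trans_lt (Order.lt_succ κ))
    exact mem_iUnion.2 ⟨y, fun x hx => ⟨trivial, (hy _ ⟨x, hx, rfl⟩).le⟩, hsmall p⟩
  rw [← mk_range_eq graph hinj]
  refine (mk_le_mk_of_subset hsub).trans ((mk_iUnion_le _).trans ?_)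
  rw [mk_ord_toType]
  refine (mul_le_mul_right (ciSup_le' fun y => ?_) _).trans (mul_eq_self hreg.aleph0_le).le
  refine le_trans (hκ.mk_small_subsets_le hpow _ ?_) (Order.le_succ κ)
  rw [mk_setProd, mk_univ, mk_ord_toType]
  exact mul_le_of_le hκ.aleph0_le le_rfl
    (Order.lt_succ_iff.1 (mk_Iic_toType_lt hreg.aleph0_le y))

/-- `Col(κ, κ⁺)` has an antichain of size `κ`. -/
theorem exists_antichain {κ : Cardinal.{u}} (hκ : κ.IsRegular) :
    ∃ a : κ.ord.ToType → Col κ (Order.succ κ), ∀ i j, i ≠ j → ∀ r, r ≤ a i → ¬ r ≤ a j := by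
  classical
  have : Nonempty κ.ord.ToType := nonempty_ord_toType hκ.ne_zero
  obtain ⟨k⟩ := this
  have hle : #κ.ord.ToType ≤ #(Order.succ κ).ord.ToType := by
    rw [mk_ord_toType, mk_ord_toType]
    exact Order.le_succ κ
  obtain ⟨e⟩ := hle
  refine ⟨fun i => ⟨fun x => if x = k then some (e i) else none, ?_⟩, fun i j hij r hi hj => ?_⟩
  · refine lt_of_le_of_lt (mk_le_mk_of_subset (t := {k}) ?_) ?_
    · intro x hx
      by_contra h
      exact hx (if_neg h)
    · rw [mk_singleton]
      exact one_lt_aleph0.trans_le hκ.aleph0_le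
  · have h1 := hi k (e i) (if_pos rfl)
    have h2 := hj k (e j) (if_pos rfl)
    exact hij (e.injective (Option.some.inj (h1.symm.trans h2)))

end Col

/-! ### The ideal induced by a tower -/

namespace SetIdeal

/-- A uniform ideal on `κ` contains the bounded sets, so membership in it depends only on a tail. -/
theorem IsUniform.mem_of_eventually {κ : Cardinal.{u}} {I : Order.Ideal (Set κ.ord.ToType)}
    (hI : IsUniform I) (hκ : ℵ₀ ≤ κ) {A B : Set κ.ord.ToType} (hA : A ∈ I)
    (h : ∀ᶠ i in atTop, i ∈ B → i ∈ A) : B ∈ I := by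
  have : Nonempty κ.ord.ToType := nonempty_ord_toType (aleph0_pos.trans_le hκ).ne'
  obtain ⟨b, hb⟩ := eventually_atTop.1 h
  refine mem_of_sdiff_mem (B := A) (I.lower ?_ (hI (Iio b) ?_)) hA
  · rintro i ⟨hiB, hiA⟩
    exact not_le.1 fun hbi => hiA (hb i hbi hiB)
  · rw [mk_ord_toType]
    exact mk_Iio_toType_lt b

/-- Sets `T α i`, for `α < κ⁺` and `i < κ`, forming a tower modulo `J` at almost all coordinates:
they are `J`-positive, `T α i` concentrates on `π ⁻¹' {i}`, and every function on `κ⁺` with at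
most `κ` values is constant modulo `J` on almost all the sets at some level. -/
structure IsGenericTower {κ : Cardinal.{u}} (J : Order.Ideal (Set (Order.succ κ).ord.ToType))
    (π : (Order.succ κ).ord.ToType → κ.ord.ToType)
    (T : (Order.succ κ).ord.ToType → κ.ord.ToType → Set (Order.succ κ).ord.ToType) : Prop where
  notMem : ∀ α i, T α i ∉ J
  descending : ∀ α, ∀ β < α, ∀ᶠ i in atTop, T α i \ T β i ∈ J
  fiber : ∀ α i, T α i \ π ⁻¹' {i} ∈ J
  decides : ∀ (M : Type u), #M ≤ κ → ∀ F : (Order.succ κ).ord.ToType → M,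
    ∃ α, ∀ᶠ i in atTop, ∃ m, T α i \ F ⁻¹' {m} ∈ J

namespace IsGenericTower

variable {κ : Cardinal.{u}} {J : Order.Ideal (Set (Order.succ κ).ord.ToType)}
  {π : (Order.succ κ).ord.ToType → κ.ord.ToType}
  {T : (Order.succ κ).ord.ToType → κ.ord.ToType → Set (Order.succ κ).ord.ToType}
  {I : Order.Ideal (Set κ.ord.ToType)}

theorem mem_of_le (hT : IsGenericTower J π T) (hκ : ℵ₀ ≤ κ) (hI : IsUniform I)
    {A : Set (Order.succ κ).ord.ToType} {α β : (Order.succ κ).ord.ToType} (hβα : β ≤ α)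
    (h : {i | T β i ∩ A ∉ J} ∈ I) : {i | T α i ∩ A ∉ J} ∈ I := by
  rcases hβα.eq_or_lt with rfl | hlt
  · exact h
  · refine hI.mem_of_eventually hκ h ((hT.descending α β hlt).mono fun i hi hα hβ => hα ?_)
    refine J.lower ?_ (Order.Ideal.sup_mem hi hβ)
    rintro x ⟨hx, hxA⟩
    by_cases hxβ : x ∈ T β i
    · exact Or.inr ⟨hxβ, hxA⟩
    · exact Or.inl ⟨hx, hxβ⟩

/-- The ideal of those `A ⊆ κ⁺` which, at some level of the tower, are `J`-null on `T α i` for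
`I`-almost all `i`. -/
def ideal (hT : IsGenericTower J π T) (hκ : ℵ₀ ≤ κ) (hI : IsUniform I) :
    Order.Ideal (Set (Order.succ κ).ord.ToType) where
  carrier := {A | ∃ α, {i | T α i ∩ A ∉ J} ∈ I}
  lower' := by
    rintro A B hBA ⟨α, hα⟩
    refine ⟨α, I.lower ?_ hα⟩
    exact fun i hi hA => hi (J.lower (inter_subset_inter_right _ hBA) hA)
  nonempty' := by
    have : Nonempty (Order.succ κ).ord.ToType := nonempty_ord_toType (isRegular_succ hκ).ne_zero
    refine ⟨∅, Classical.arbitrary _, I.lower (fun i hi => (hi ?_).elim) (Order.Ideal.bot_mem I)⟩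
    rw [inter_empty]
    exact Order.Ideal.bot_mem J
  directed' := by
    rintro A ⟨α, hα⟩ B ⟨β, hβ⟩
    refine ⟨A ∪ B, ⟨max α β, ?_⟩, subset_union_left, subset_union_right⟩
    refine I.lower ?_ (Order.Ideal.sup_mem (hT.mem_of_le hκ hI (le_max_left α β) hα)
      (hT.mem_of_le hκ hI (le_max_right α β) hβ))
    intro i hi
    by_contra h
    have h := not_or.1 h
    refine hi ?_
    rw [inter_union_distrib_left]
    exact Order.Ideal.sup_mem (not_not.1 h.1) (not_not.1 h.2)

theorem mem_ideal (hT : IsGenericTower J π T) (hκ : ℵ₀ ≤ κ) (hI : IsUniform I)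
    {A : Set (Order.succ κ).ord.ToType} :
    A ∈ hT.ideal hκ hI ↔ ∃ α, {i | T α i ∩ A ∉ J} ∈ I :=
  Iff.rfl

theorem isComplete_ideal (hT : IsGenericTower J π T) (hJ : IsNormal J) (hκ : ℵ₀ ≤ κ)
    (hI : IsUniform I) {δ : Cardinal.{u}} (hδ : δ ≤ κ) (hIδ : IsComplete I δ) :
    IsComplete (hT.ideal hκ hI) δ := by
  intro 𝒮 h𝒮 hmem
  have : Nonempty (Order.succ κ).ord.ToType :=
    nonempty_ord_toType (isRegular_succ hκ).ne_zero
  choose! α hα using fun A hA => (hT.mem_ideal hκ hI).1 (hmem A hA)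
  obtain ⟨b, hb⟩ := (isRegular_succ hκ).exists_forall_lt (α '' 𝒮)
    (mk_image_le.trans_lt ((h𝒮.trans_le hδ).trans (Order.lt_succ κ)))
  refine ⟨b, I.lower ?_ (hIδ ((fun A => {i | T b i ∩ A ∉ J}) '' 𝒮)
    (mk_image_le.trans_lt h𝒮) ?_)⟩
  · intro i hi
    by_contra hno
    refine hi ?_
    rw [sUnion_eq_iUnion, inter_iUnion]
    refine hJ.iUnion_mem hκ (h𝒮.trans_le hδ).le _ fun A => ?_
    by_contra h
    exact hno ⟨_, ⟨A, A.2, rfl⟩, h⟩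
  · rintro _ ⟨A, hA, rfl⟩
    exact hT.mem_of_le hκ hI (hb _ ⟨A, hA, rfl⟩).le (hα A hA)

theorem isUniform_ideal (hT : IsGenericTower J π T) (hJ : IsNormal J) (hκ : ℵ₀ ≤ κ)
    (hI : IsUniform I) : IsUniform (hT.ideal hκ hI) := by
  intro Y hY
  rw [mk_ord_toType] at hY
  obtain ⟨b, hb⟩ := (isRegular_succ hκ).exists_forall_lt Y hY
  refine ⟨b, I.lower (fun i hi => (hi ?_).elim) (Order.Ideal.bot_mem I)⟩
  exact J.lower (inter_subset_right.trans fun x hx => (hb x hx).le) (hJ.1 b)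

theorem preimage_mem_ideal (hT : IsGenericTower J π T) (hκ : ℵ₀ ≤ κ) (hI : IsUniform I)
    (A : Set κ.ord.ToType) : π ⁻¹' A ∈ hT.ideal hκ hI ↔ A ∈ I := by
  have key : ∀ α, {i | T α i ∩ π ⁻¹' A ∉ J} = A := by
    intro α
    ext i
    constructor
    · intro hi
      by_contra hiA
      refine hi (J.lower ?_ (hT.fiber α i))
      rintro x ⟨hx, hxA⟩
      exact ⟨hx, fun h => hiA (mem_singleton_iff.1 h ▸ hxA)⟩
    · intro hi hmem
      refine hT.notMem α i (J.lower ?_ (Order.Ideal.sup_mem (hT.fiber α i) hmem))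
      intro x hx
      by_cases h : π x = i
      · exact Or.inr ⟨hx, by rwa [mem_preimage, h]⟩
      · exact Or.inl ⟨hx, h⟩
  have : Nonempty (Order.succ κ).ord.ToType := nonempty_ord_toType (isRegular_succ hκ).ne_zero
  simp only [mem_ideal, key, exists_const]

/-- Modulo the induced ideal, every function with at most `κ` values factors through `π`. -/
theorem exists_comp_eq (hT : IsGenericTower J π T) (hκ : ℵ₀ ≤ κ) (hI : IsUniform I)
    {M : Type u} (hM : #M ≤ κ) (F : (Order.succ κ).ord.ToType → M) :
    ∃ g : κ.ord.ToType → M, {x | F x ≠ g (π x)} ∈ hT.ideal hκ hI := by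
  classical
  have : Nonempty (Order.succ κ).ord.ToType := nonempty_ord_toType (isRegular_succ hκ).ne_zero
  have : Nonempty M := ⟨F (Classical.arbitrary _)⟩
  obtain ⟨α, hα⟩ := hT.decides M hM F
  have hg : ∀ i, ∃ m, (∃ m, T α i \ F ⁻¹' {m} ∈ J) → T α i \ F ⁻¹' {m} ∈ J := by
    intro i
    by_cases h : ∃ m, T α i \ F ⁻¹' {m} ∈ J
    · exact h.imp fun m hm _ => hm
    · exact ⟨Classical.arbitrary M, fun h' => (h h').elim⟩
  choose g hg using hg
  refine ⟨g, α, hI.mem_of_eventually hκ (Order.Ideal.bot_mem I) (hα.mono fun i hi hmem => ?_)⟩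
  refine (hmem (J.lower ?_ (Order.Ideal.sup_mem (hg i hi) (hT.fiber α i)))).elim
  rintro x ⟨hx, hne⟩
  by_cases h : π x = i
  · exact Or.inl ⟨hx, fun h' => hne (by rw [h]; exact h')⟩
  · exact Or.inr ⟨hx, h⟩

theorem exists_powerMod_iso (hT : IsGenericTower J π T) (hκ : ℵ₀ ≤ κ) (hI : IsUniform I) :
    ∃ e : PowerMod I ≃o PowerMod (hT.ideal hκ hI), ∀ A : Set κ.ord.ToType,
      e (PowerMod.mk I A) = PowerMod.mk (hT.ideal hκ hI) (π ⁻¹' A) := by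
  have hle : ∀ A B : Set κ.ord.ToType,
      π ⁻¹' A \ π ⁻¹' B ∈ hT.ideal hκ hI ↔ A \ B ∈ I := fun A B => by
    rw [← preimage_sdiff, hT.preimage_mem_ideal hκ hI]
  let f : PowerMod I → PowerMod (hT.ideal hκ hI) :=
    Quotient.lift (fun A => PowerMod.mk (hT.ideal hκ hI) (π ⁻¹' A)) fun A B hAB => by
      have hAB := (modSetoid_iff I A B).1 hAB
      exact le_antisymm ((hle A B).2 hAB.1) ((hle B A).2 hAB.2)
  have hf : ∀ x y, f x ≤ f y ↔ x ≤ y := by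
    rintro ⟨A⟩ ⟨B⟩
    exact hle A B
  have hsurj : Function.Surjective f := by
    rintro ⟨A⟩
    have hcard : #(ULift.{u} Prop) ≤ κ := (lt_aleph0_of_finite _).le.trans hκ
    obtain ⟨g, hg⟩ := hT.exists_comp_eq hκ hI hcard fun x => ⟨x ∈ A⟩
    refine ⟨PowerMod.mk I {i | (g i).down}, le_antisymm ?_ ?_⟩
    · refine (hT.ideal hκ hI).lower ?_ hg
      rintro x ⟨hx, hxA⟩ h
      exact hxA ((congrArg ULift.down h).mpr hx)
    · refine (hT.ideal hκ hI).lower ?_ hg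
      rintro x ⟨hxA, hx⟩ h
      exact hx ((congrArg ULift.down h).mp hxA)
  exact ⟨RelIso.ofSurjective (OrderEmbedding.ofMapLEIff f hf) hsurj, fun A => rfl⟩

theorem exists_reducedPower_equiv (hT : IsGenericTower J π T) (hκ : ℵ₀ ≤ κ) (hI : IsUniform I)
    {M : Type u} (hM : #M ≤ κ) :
    ∃ e : ReducedPower M I ≃ ReducedPower M (hT.ideal hκ hI), ∀ f : κ.ord.ToType → M,
      e (ReducedPower.mk I f) = ReducedPower.mk (hT.ideal hκ hI) (f ∘ π) := by
  have heq : ∀ f g : κ.ord.ToType → M,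
      ReducedPower.mk (hT.ideal hκ hI) (f ∘ π) = ReducedPower.mk (hT.ideal hκ hI) (g ∘ π) ↔
        ReducedPower.mk I f = ReducedPower.mk I g := fun f g => by
    rw [ReducedPower.mk_eq_iff, ReducedPower.mk_eq_iff]
    exact hT.preimage_mem_ideal hκ hI {i | f i ≠ g i}
  let F : ReducedPower M I → ReducedPower M (hT.ideal hκ hI) :=
    Quotient.lift (fun f => ReducedPower.mk (hT.ideal hκ hI) (f ∘ π)) fun f g hfg =>
      (heq f g).2 (Quotient.sound hfg)
  have hF : Function.Bijective F := by
    constructor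
    · rintro ⟨f⟩ ⟨g⟩ h
      exact (heq f g).1 h
    · rintro ⟨f⟩
      obtain ⟨g, hg⟩ := hT.exists_comp_eq hκ hI hM f
      exact ⟨ReducedPower.mk I g, ((ReducedPower.mk_eq_iff _ _ _).2 hg).symm⟩
  exact ⟨Equiv.ofBijective F hF, fun f => rfl⟩

end IsGenericTower

/-- The map `π` sends `x` to the least `i` such that `x` belongs to the set represented by the
`i`-th element of an antichain of size `κ`, and `T α i` is the set represented by the `i`-th entry
of the `α`-th function of a generic tower below this antichain. -/
theorem exists_isGenericTower {κ : Cardinal.{u}} (hκ : κ.IsRegular)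
    (hdiamond : Diamond (cofSet (Order.succ κ).ord.ToType κ))
    {J : Order.Ideal (Set (Order.succ κ).ord.ToType)} (hJ : IsNormal J)
    (e : PowerMod J ≃o BooleanCompletion (Col κ (Order.succ κ))) :
    ∃ π T, IsGenericTower J π T := by
  classical
  have : Nonempty κ.ord.ToType := nonempty_ord_toType hκ.ne_zero
  obtain ⟨S, hS⟩ := exists_isDenseRep e
  obtain ⟨a, ha⟩ := Col.exists_antichain hκ
  have : Nonempty (Col κ (Order.succ κ)) := ⟨a (Classical.arbitrary _)⟩
  have hclosed : IsChainClosed κ (Col κ (Order.succ κ)) := Col.isChainClosed hκ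
  have hpow := hS.powerlt_le hκ hJ hclosed
  obtain ⟨p, hpa, hp, hD⟩ :=
    exists_generic_tower hκ hpow hdiamond hclosed (Col.mk_le hκ hpow) a
  have hU : ∀ (ι : Type u), #ι ≤ κ → ∀ A : ι → Set (Order.succ κ).ord.ToType,
      (∀ i, A i ∈ J) → ⋃ i, A i ∈ J := fun ι hι A hA => hJ.iUnion_mem hκ.aleph0_le hι A hA
  have hπ : ∀ x, ∃ i, (∃ j, x ∈ S (a j)) → x ∈ S (a i) ∧ ∀ j, x ∈ S (a j) → i ≤ j := by
    intro x
    by_cases h : ∃ j, x ∈ S (a j)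
    · obtain ⟨i, hi, hmin⟩ := wellFounded_lt.has_min {j | x ∈ S (a j)} h
      exact ⟨i, fun _ => ⟨hi, fun j hj => not_lt.1 (hmin j hj)⟩⟩
    · exact ⟨Classical.arbitrary _, fun h' => (h h').elim⟩
  choose π hπ using hπ
  refine ⟨π, fun α i => S (p α i), fun α i => hS.notMem _, fun α β hβ => ?_, fun α i => ?_,
    fun M hM F => ?_⟩
  · exact (hp α β hβ).mono fun i hi => hS.mono _ _ hi
  · have hmeet : ⋃ j : Iio i, S (a j) ∩ S (a i) ∈ J :=
      hU _ (mk_Iio_toType_lt i).le _ fun j => hS.inter_mem _ _ (ha _ _ (ne_of_lt j.2))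
    refine J.lower ?_ (Order.Ideal.sup_mem (hS.mono _ _ (hpa α i)) hmeet)
    rintro x ⟨hx, hxi⟩
    by_cases hxa : x ∈ S (a i)
    · obtain ⟨h1, h2⟩ := hπ x ⟨i, hxa⟩
      exact Or.inr (mem_iUnion.2 ⟨⟨π x, lt_of_le_of_ne (h2 i hxa) hxi⟩, h1, hxa⟩)
    · exact Or.inl ⟨hx, hxa⟩
  · exact hD {q | ∃ m, S q \ F ⁻¹' {m} ∈ J} fun q => hS.exists_decides hU hM F q

end SetIdeal

theorem mainTheorem7 (κ : Cardinal.{u}) (hκ : κ.IsRegular)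
    (hdiamond : Diamond (cofSet (Order.succ κ).ord.ToType κ))
    (hJ : ∃ J : Order.Ideal (Set (Order.succ κ).ord.ToType), SetIdeal.IsNormal J ∧
      Nonempty (SetIdeal.PowerMod J ≃o BooleanCompletion (Col κ (Order.succ κ)))) :
    ∃ π : (Order.succ κ).ord.ToType → κ.ord.ToType,
      ∀ δ : Cardinal.{u}, δ.IsRegular → δ ≤ κ →
      ∀ I : Order.Ideal (Set κ.ord.ToType), SetIdeal.IsComplete I δ → SetIdeal.IsUniform I →
      ∃ I' : Order.Ideal (Set (Order.succ κ).ord.ToType),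
        SetIdeal.IsComplete I' δ ∧ SetIdeal.IsUniform I' ∧ (I.IsProper → I'.IsProper) ∧
        (∀ A : Set κ.ord.ToType, A ∈ I ↔ π ⁻¹' A ∈ I') ∧
        (∃ e : SetIdeal.PowerMod I ≃o SetIdeal.PowerMod I', ∀ A : Set κ.ord.ToType,
          e (SetIdeal.PowerMod.mk I A) = SetIdeal.PowerMod.mk I' (π ⁻¹' A)) ∧
        ∀ μ : Ordinal.{u}, μ ≤ κ.ord →
          ∃ e : SetIdeal.ReducedPower μ.ToType I ≃ SetIdeal.ReducedPower μ.ToType I',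
            ∀ f : κ.ord.ToType → μ.ToType,
              e (SetIdeal.ReducedPower.mk I f) = SetIdeal.ReducedPower.mk I' (f ∘ π) := by
  obtain ⟨J, hJ, ⟨e⟩⟩ := hJ
  obtain ⟨π, T, hT⟩ := SetIdeal.exists_isGenericTower hκ hdiamond hJ e
  have h0 := hκ.aleph0_le
  refine ⟨π, fun δ _ hδ I hIδ hI => ⟨hT.ideal h0 hI, hT.isComplete_ideal hJ h0 hI hδ hIδ,
    hT.isUniform_ideal hJ h0 hI, fun hproper => ⟨fun huniv => ?_⟩,
    fun A => (hT.preimage_mem_ideal h0 hI A).symm, hT.exists_powerMod_iso h0 hI,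
    fun μ hμ => hT.exists_reducedPower_equiv h0 hI ?_⟩⟩
  · have hmem : π ⁻¹' Set.univ ∈ hT.ideal h0 hI := by
      rw [← SetLike.mem_coe, huniv]
      trivial
    exact hproper.ne_univ (eq_univ_of_forall fun A =>
      I.lower (Set.subset_univ A) ((hT.preimage_mem_ideal h0 hI Set.univ).1 hmem))
  · rw [mk_toType]
    exact (Ordinal.card_le_card hμ).trans (card_ord κ).le
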